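/- Let $G$ be a finite plane embedded graph, i.e. a ribbon graph (equivalently, a cellularly embedded graph, each component in its own closed surface) all of whose components have genus zero; loops, multiple edges, isolated vertices and several components are allowed. Let $G_m$ be its medial graph (one 4-valent vertex on each edge of $G$, edges following the face boundaries of $G$, and a free closed curve for each isolated vertex of $G$), with the faces of $G_m$ that contain a vertex of $G$ coloured black and the other faces coloured white. A state $s$ of $G_m$ chooses at each vertex one of the three ways to pair the four incident half-edges: the white split (the two half-edges on the boundary of each white sector are paired), the black split (the two half-edges on the boundary of each black sector are paired), or the crossing (opposite half-edges are paired). The number of closed curves that result is $c(s)$. The Penrose polynomial is $$P(G;\lambda)=\sum_{s}\omega(s)\,\lambda^{c(s)}\in\mathbb Z[\lambda],$$ where $\omega(s)$ is the product over the vertices of $G_m$ of the weights $1$ (white split), $0$ (black split), $-1$ (crossing); equivalently, $P(G;\lambda)=\sum_s(-1)^{cr(s)}\lambda^{c(s)}$ over the states without black splits, $cr(s)$ being the number of crossings. For $A\subseteq E(G)$ let $G^{\tau(A)}$ be the partial Petrial, obtained from the ribbon graph $G$ by giving a half-twist to each edge in $A$. For an embedded graph $H$ let $H^*$ be its geometric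 dual (formed component by component: one vertex for each face of $H$, and one edge for each edge $e$ of $H$, joining the faces on the two sides of $e$). Let $\chi(H;\lambda)$ be the chromatic polynomial of the underlying graph of $H$, whose value at each $k\in\mathbb N$ is the number of proper $k$-colourings (zero if $H$ has a loop). Then $$P(G;\lambda)=\sum_{A\subseteq E(G)}\chi\bigl((G^{\tau(A)})^*;\lambda\bigr).$$ In particular (Aigner's inequality), $\chi(G^*;k)\le P(G;k)$ for all $k\in\mathbb N$. -/

import Mathlib

/-! ### The chromatic polynomial of a multigraph -/

namespace Graph

/-- A proper `k`-colouring of a multigraph: the two ends of every edge get different colours.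
A graph with a loop has none. -/
def IsProperColoring {α β : Type*} (H : Graph α β) {k : ℕ} (c : H.vertexSet → Fin k) : Prop :=
  ∀ (e : β) (x y : H.vertexSet), H.IsLink e x y → c x ≠ c y

/-- The number of proper `k`-colourings. -/
noncomputable def numProperColorings {α β : Type*} (H : Graph α β) (k : ℕ) : ℕ :=
  Nat.card {c : H.vertexSet → Fin k // H.IsProperColoring c}

/-- The colourings that are constant along a relation are the colourings of the classes of the
equivalence relation generated by it. -/
theorem card_colorings_constant {V : Type*} [Finite V] (r : V → V → Prop) (k : ℕ) :
    Nat.card {c : V → Fin k // ∀ x y, r x y → c x = c y} = k ^ Nat.card (Quot r) := by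
  have e : {c : V → Fin k // ∀ x y, r x y → c x = c y} ≃ (Quot r → Fin k) :=
    { toFun := fun c => Quot.lift c.1 c.2
      invFun := fun g => ⟨fun x => g (Quot.mk r x), fun x y h => congrArg g (Quot.sound h)⟩
      left_inv := fun c => rfl
      right_inv := fun g => by
        funext q
        induction q using Quot.ind
        rfl }
  rw [Nat.card_congr e, Nat.card_fun, Nat.card_eq_fintype_card (α := Fin k), Fintype.card_fin]

/-- The number of proper `k`-colourings of a multigraph with finitely many vertices is a
polynomial function of `k`. -/
theorem exists_chromaticPolynomial {α β : Type*} (H : Graph α β) [Finite H.vertexSet] :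
    ∃ p : Polynomial ℤ, ∀ k : ℕ, p.eval (k : ℤ) = (H.numProperColorings k : ℤ) := by
  classical
  have := Fintype.ofFinite H.vertexSet
  let S : Finset (H.vertexSet × H.vertexSet) :=
    Finset.univ.filter fun q => ∃ e, H.IsLink e q.1 q.2
  refine ⟨∑ t ∈ S.powerset, (-1) ^ t.card *
    Polynomial.X ^ Nat.card (Quot fun x y : H.vertexSet => (x, y) ∈ t), fun k => ?_⟩
  have h1 : (H.numProperColorings k : ℤ) =
      ∑ c : H.vertexSet → Fin k, ∏ q ∈ S, (1 + -(if c q.1 = c q.2 then (1 : ℤ) else 0)) := by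
    have h2 : ∀ c : H.vertexSet → Fin k,
        (∏ q ∈ S, (1 + -(if c q.1 = c q.2 then (1 : ℤ) else 0))) =
          if H.IsProperColoring c then 1 else 0 := by
      intro c
      split_ifs with hc
      · refine Finset.prod_eq_one fun q hq => ?_
        obtain ⟨e, he⟩ := (Finset.mem_filter.1 hq).2
        rw [if_neg (hc e _ _ he)]
        norm_num
      · unfold IsProperColoring at hc
        push Not at hc
        obtain ⟨e, x, y, he, hxy⟩ := hc
        refine Finset.prod_eq_zero (i := (x, y))
          (Finset.mem_filter.2 ⟨Finset.mem_univ _, e, he⟩) ?_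
        simp [hxy]
    rw [Finset.sum_congr rfl fun c _ => h2 c, Finset.sum_boole, numProperColorings,
      Nat.card_eq_fintype_card, Fintype.card_subtype]
  rw [h1]
  simp_rw [Finset.prod_one_add]
  rw [Finset.sum_comm, Polynomial.eval_finsetSum]
  refine Finset.sum_congr rfl fun t _ => ?_
  have h3 := card_colorings_constant (fun x y : H.vertexSet => (x, y) ∈ t) k
  rw [Nat.card_eq_fintype_card, Fintype.card_subtype] at h3
  have h4 : ∀ c : H.vertexSet → Fin k,
      (∏ q ∈ t, -(if c q.1 = c q.2 then (1 : ℤ) else 0)) =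
        (-1) ^ t.card * if ∀ x y, (x, y) ∈ t → c x = c y then 1 else 0 := by
    intro c
    rw [Finset.prod_neg]
    congr 1
    split_ifs with hc
    · exact Finset.prod_eq_one fun q hq => if_pos (hc q.1 q.2 hq)
    · push Not at hc
      obtain ⟨x, y, hq, hxy⟩ := hc
      exact Finset.prod_eq_zero hq (if_neg hxy)
  rw [Finset.sum_congr rfl fun c _ => h4 c, ← Finset.mul_sum, Finset.sum_boole, h3]
  simp

/-- The chromatic polynomial of a multigraph with finitely many vertices: the polynomial whose
value at each natural number `k` is the number of proper `k`-colourings. -/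
noncomputable def chromaticPolynomial {α β : Type*} (H : Graph α β) [Finite H.vertexSet] :
    Polynomial ℤ :=
  Classical.choose H.exists_chromaticPolynomial

theorem chromaticPolynomial_eval {α β : Type*} (H : Graph α β) [Finite H.vertexSet] (k : ℕ) :
    H.chromaticPolynomial.eval (k : ℤ) = (H.numProperColorings k : ℤ) :=
  Classical.choose_spec H.exists_chromaticPolynomial k

end Graph

/-! ### Embedded graphs as arrow presentations -/

/-- The ends of the marking arrows with labels in `E`. Each label `e` is carried by two arrows,
`(e, false)` and `(e, true)`; the tail of the arrow `(e, a)` is `(e, a, false)` and its head is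
`(e, a, true)`. In the ribbon graph these are the four corners of the edge disc `e`.
The same type is used for the half-edges of a 4-regular graph, four at each vertex. -/
abbrev EdgeCorner (E : Type*) := E × Bool × Bool

namespace EdgeCorner

variable {E : Type*}

/-- From one end of an arrow to the other end of the same arrow. The arrows are the two line
segments in which the edge disc meets the vertex discs. -/
def acrossArrow (x : EdgeCorner E) : EdgeCorner E := (x.1, x.2.1, !x.2.2)

/-- From a corner of an edge disc along the free side of that disc. Both arrows are directed
consistently with an orientation of the boundary of the edge disc, so the two free sides join
the head of either arrow to the tail of the other one. -/
def alongSide (x : EdgeCorner E) : EdgeCorner E := (x.1, !x.2.1, !x.2.2)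

/-- From a corner of an edge disc to the opposite corner: heads are matched with heads and tails
with tails. -/
def opposite (x : EdgeCorner E) : EdgeCorner E := (x.1, !x.2.1, x.2.2)

/-- Reversing the arrow `(e, true)` for every `e ∈ A`. -/
def twist [DecidableEq E] (A : Finset E) : Equiv.Perm (EdgeCorner E) :=
  Function.Involutive.toPerm
    (fun x => if x.1 ∈ A ∧ x.2.1 = true then acrossArrow x else x) (by
      rintro ⟨e, a, h⟩
      by_cases hA : e ∈ A <;> cases a <;> simp [acrossArrow, hA])

/-- For `e ∈ A` the arrows of `e` are replaced by two new ones: the new arrow `(e, a)` goes from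
the head of the old arrow `(e, a)` to the tail of the old arrow `(e, !a)`. The permutation sends
an end of a new arrow to the end of an old arrow at which it lies. -/
def dualize [DecidableEq E] (A : Finset E) : Equiv.Perm (EdgeCorner E) where
  toFun x :=
    if x.1 ∈ A then (if x.2.2 = true then (x.1, !x.2.1, false) else (x.1, x.2.1, true)) else x
  invFun x :=
    if x.1 ∈ A then (if x.2.2 = true then (x.1, x.2.1, false) else (x.1, !x.2.1, true)) else x
  left_inv := by
    rintro ⟨e, a, h⟩
    by_cases hA : e ∈ A <;> cases h <;> simp [hA]
  right_inv := by
    rintro ⟨e, a, h⟩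
    by_cases hA : e ∈ A <;> cases h <;> simp [hA]

end EdgeCorner

/-- An arrow presentation with label set `E`: a collection of circles carrying disjoint labelled
arrows, each label occurring on exactly two arrows. The circles that carry arrows are recorded by
the arcs between consecutive arrows: `arc x` is the other end of the arc that starts at the end
`x` of an arrow. The circles without arrows (isolated vertices) are counted by `bare`. -/
structure ArrowPresentation (E : Type*) where
  arc : EdgeCorner E → EdgeCorner E
  arc_arc : ∀ x, arc (arc x) = x
  arc_ne : ∀ x, arc x ≠ x
  bare : ℕ

/-! ### Checkerboard coloured 4-regular graphs, their states, and transition polynomials -/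

/-- A 4-regular embedded graph with vertex set `V` and a checkerboard colouring. The half-edges at
the vertex `v` are, in cyclic order, `(v, false, false)`, `(v, false, true)`, `(v, true, false)`,
`(v, true, true)`. The sector between `(v, a, false)` and `(v, a, true)` is black, the sector
between `(v, a, true)` and `(v, !a, false)` is white. The half-edges `x` and `mate x` form an
edge; `freeLoops` is the number of closed curves without vertices. (The edges join black sides to
black sides and white sides to white sides, so this determines the embedding.) -/
structure CheckerboardGraph (V : Type*) where
  mate : EdgeCorner V → EdgeCorner V
  mate_mate : ∀ x, mate (mate x) = x
  mate_ne : ∀ x, mate x ≠ x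
  freeLoops : ℕ

/-- The three vertex states. -/
inductive VertexState where
  | whiteSplit
  | blackSplit
  | crossing
  deriving DecidableEq

instance : Fintype VertexState where
  elems := {.whiteSplit, .blackSplit, .crossing}
  complete s := by cases s <;> simp

/-- The partition of the four half-edges at a vertex into two pairs. A white split pairs the two
half-edges on the boundary of each white sector, a black split pairs the two half-edges on the
boundary of each black sector, a crossing pairs opposite half-edges. -/
def VertexState.pairing {V : Type*} : VertexState → EdgeCorner V → EdgeCorner V
  | .whiteSplit => EdgeCorner.alongSide
  | .blackSplit => EdgeCorner.acrossArrow
  | .crossing => EdgeCorner.opposite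

namespace CheckerboardGraph

variable {V : Type*}

/-- The number `c(s)` of components (closed curves) of a graph state `s`. -/
noncomputable def stateComponents (F : CheckerboardGraph V) (s : V → VertexState) : ℕ :=
  Nat.card (Quot fun x y : EdgeCorner V => y = F.mate x ∨ y = (s x.1).pairing x) + F.freeLoops

/-- The transition polynomial: the sum over all graph states `s` of `ω(s) X ^ c(s)`, where `ω(s)`
is the product of the weights `w v (s v)` of the vertex states. -/
noncomputable def transitionPolynomial [Fintype V] [DecidableEq V] {R : Type*} [CommRing R]
    (F : CheckerboardGraph V) (w : V → VertexState → R) : Polynomial R :=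
  ∑ s : V → VertexState, Polynomial.C (∏ v, w v (s v)) * Polynomial.X ^ F.stateComponents s

end CheckerboardGraph

/-- The weights `1` of a white split, `0` of a black split and `-1` of a crossing. -/
def penroseWeight : VertexState → ℤ
  | .whiteSplit => 1
  | .blackSplit => 0
  | .crossing => -1

namespace ArrowPresentation

variable {E : Type*}

/-- The circles, that is, the vertices of the embedded graph. -/
abbrev Circle (G : ArrowPresentation E) :=
  Quot (fun x y : EdgeCorner E => y = G.arc x ∨ y = x.acrossArrow) ⊕ Fin G.bare

/-- The circle on which an end of an arrow lies. -/
def circleOf (G : ArrowPresentation E) (x : EdgeCorner E) : G.Circle := Sum.inl (Quot.mk _ x)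

/-- The underlying abstract multigraph: its vertices are the circles, its edges are the labels,
and `e` joins the circles (possibly equal) that carry its two arrows. -/
def toGraph (G : ArrowPresentation E) : Graph G.Circle E where
  vertexSet := Set.univ
  IsLink e u v :=
    (u = G.circleOf (e, false, false) ∧ v = G.circleOf (e, true, false)) ∨
      (u = G.circleOf (e, true, false) ∧ v = G.circleOf (e, false, false))
  isLink_symm _ _ := ⟨fun _ _ h => h.elim (fun h => .inr ⟨h.2, h.1⟩) (fun h => .inl ⟨h.2, h.1⟩)⟩
  eq_or_eq_of_isLink_of_isLink := by
    rintro e x y v w (⟨rfl, rfl⟩ | ⟨rfl, rfl⟩) (⟨rfl, rfl⟩ | ⟨rfl, rfl⟩) <;> simp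
  left_mem_of_isLink _ _ _ _ := Set.mem_univ _

instance [Finite E] (G : ArrowPresentation E) : Finite G.toGraph.vertexSet :=
  inferInstanceAs (Finite (Set.univ : Set G.Circle))

/-- The number of vertices. -/
noncomputable def numVertices (G : ArrowPresentation E) : ℕ := Nat.card G.Circle

/-- The number of faces, that is, of boundary components of the ribbon graph. They follow the
arcs of the vertex circles and the free sides of the edge discs. An isolated vertex disc has one
boundary component. -/
noncomputable def numFaces (G : ArrowPresentation E) : ℕ :=
  Nat.card (Quot fun x y : EdgeCorner E => y = G.arc x ∨ y = x.alongSide) + G.bare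

/-- The number of connected components. -/
noncomputable def numComponents (G : ArrowPresentation E) : ℕ :=
  Nat.card (Quot fun x y : EdgeCorner E => y = G.arc x ∨ y = x.acrossArrow ∨ y = x.alongSide) + G.bare

/-- The Euler genus `2k - (v - e + f)` of the closed surface that is obtained by capping off the
boundary components of the ribbon graph, where `k` is its number of components. -/
noncomputable def eulerGenus (G : ArrowPresentation E) : ℤ :=
  2 * G.numComponents - (G.numVertices - Nat.card E + G.numFaces)

/-- An embedded graph is plane if it has genus zero: every component lies on a sphere. -/
def IsPlane (G : ArrowPresentation E) : Prop := G.eulerGenus = 0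

/-- Keep the arcs and replace the arrows: the new end `x` lies at the old end `ρ x`. -/
def relabel (G : ArrowPresentation E) (ρ : Equiv.Perm (EdgeCorner E)) : ArrowPresentation E where
  arc x := ρ.symm (G.arc (ρ x))
  arc_arc x := by simp [G.arc_arc]
  arc_ne x h := G.arc_ne (ρ x) (ρ.symm_apply_eq.1 h)
  bare := G.bare

/-- The partial Petrial of `G` with respect to `A`: every edge in `A` gets a half-twist, that is,
exactly one of its two arrows is reversed. -/
def partialPetrial [DecidableEq E] (G : ArrowPresentation E) (A : Finset E) :
    ArrowPresentation E :=
  G.relabel (EdgeCorner.twist A)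

/-- The partial dual of `G` with respect to `A`. -/
def partialDual [DecidableEq E] (G : ArrowPresentation E) (A : Finset E) :
    ArrowPresentation E :=
  G.relabel (EdgeCorner.dualize A)

/-- The geometric dual: the dual is formed at all edges, and the circles of the dual are the
boundaries of the faces of `G`. -/
def geometricDual [Fintype E] [DecidableEq E] (G : ArrowPresentation E) : ArrowPresentation E :=
  G.partialDual Finset.univ

/-- The medial graph with its canonical checkerboard colouring: its vertices are the edges of `G`,
the four half-edges at the vertex `e` pass through the four corners of the edge disc `e`, and they
are joined along the arcs of the vertex circles. The black sectors at `e` are those at the two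
arrows, where the vertex discs of `G` lie. An isolated vertex of `G` gives a free loop. -/
def medialGraph (G : ArrowPresentation E) : CheckerboardGraph E where
  mate := G.arc
  mate_mate := G.arc_arc
  mate_ne := G.arc_ne
  freeLoops := G.bare

/-- The Penrose polynomial. -/
noncomputable def penrosePolynomial [Fintype E] [DecidableEq E] (G : ArrowPresentation E) :
    Polynomial ℤ :=
  G.medialGraph.transitionPolynomial fun _ => penroseWeight

end ArrowPresentation

/-! Both sides are polynomials, so it suffices to compare them at each natural number `k`. There `k
^ c(s)` counts the `k`-colourings of the medial edges that are constant along the curves of the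
state `s`. Exchange the sum over states with the sum over colourings `f`. At each edge of `G` a
white split then contributes `1` and a crossing `-1`, and these cancel when all four half-edges have
one colour. What remains is the sum over `f` of a product of local factors: `1` if `f` is split with
two colours, `-1` if it is crossed with two colours, `0` otherwise (`penrosePolynomial_eval`).

The proper colourings of the dual of the partial Petrial at `A` are the `f` that are crossed on `A`
and split off `A`, so summing over `A` gives the same expression without signs.

The signs disappear because in the plane the number of crossings of `f` is even, as for closed
curves on a sphere (`IsPlane.even_card_crossings`). The medial edges of one colour form a mod 2
cycle. On a sphere such a cycle bounds a set of medial faces, that is, of circles and faces of `G`;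
this follows from Euler's formula by comparing dimensions (`range_sideSum_eq_ker_medialIncidence`).
Counting crossings with these bounding sets gives the parity. -/

namespace ArrowPresentation

variable {E : Type*}

/-! ### Mod 2 homology of the medial graph -/

/-- The arcs of the circles, that is, the edges of the medial graph. -/
abbrev ArcClass (G : ArrowPresentation E) := Quot fun x y : EdgeCorner E => y = G.arc x

/-- The circles that carry arrows. -/
abbrev MarkedCircle (G : ArrowPresentation E) :=
  Quot fun x y : EdgeCorner E => y = G.arc x ∨ y = x.acrossArrow

/-- The faces of the components with at least one edge. -/
abbrev MarkedFace (G : ArrowPresentation E) :=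
  Quot fun x y : EdgeCorner E => y = G.arc x ∨ y = x.alongSide

/-- The components with at least one edge. -/
abbrev MarkedComponent (G : ArrowPresentation E) :=
  Quot fun x y : EdgeCorner E => y = G.arc x ∨ y = x.acrossArrow ∨ y = x.alongSide

theorem arcClass_mk_eq_iff (G : ArrowPresentation E) (x y : EdgeCorner E) :
    (Quot.mk _ x : G.ArcClass) = Quot.mk _ y ↔ y = x ∨ y = G.arc x := by
  constructor
  · intro h
    have h1 := Quot.eqvGen_exact h
    clear h
    induction h1 with
    | rel a b h => exact .inr h
    | refl a => exact .inl rfl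
    | symm a b _ ih =>
      rcases ih with rfl | rfl
      · exact .inl rfl
      · exact .inr (G.arc_arc _).symm
    | trans a b c _ _ ih1 ih2 =>
      rcases ih1 with rfl | rfl <;> rcases ih2 with rfl | rfl <;> simp [G.arc_arc]
  · rintro (rfl | rfl)
    · rfl
    · exact Quot.sound rfl

/-- The sum of a function on the circles and a function on the faces, as a function on the
arcs. -/
def sideSum (G : ArrowPresentation E) :
    ((G.MarkedCircle → ZMod 2) × (G.MarkedFace → ZMod 2)) →ₗ[ZMod 2] (G.ArcClass → ZMod 2) :=
  (LinearMap.funLeft _ _ (Quot.map id fun _ _ h => .inl h)).coprod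
    (LinearMap.funLeft _ _ (Quot.map id fun _ _ h => .inl h))

theorem sideSum_apply (G : ArrowPresentation E) (h : G.MarkedCircle → ZMod 2)
    (g : G.MarkedFace → ZMod 2) (x : EdgeCorner E) :
    G.sideSum (h, g) (Quot.mk _ x) = h (Quot.mk _ x) + g (Quot.mk _ x) := rfl

section Finite

variable [Fintype E]

theorem sum_arcClass_fiber [DecidableEq E] (G : ArrowPresentation E) {M : Type*} [AddCommMonoid M]
    [DecidableEq G.ArcClass] (u : EdgeCorner E → M) (x : EdgeCorner E) :
    (∑ y : EdgeCorner E with (Quot.mk _ y : G.ArcClass) = Quot.mk _ x, u y) = u x + u (G.arc x) := by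
  have : (Finset.univ.filter fun y : EdgeCorner E => (Quot.mk _ y : G.ArcClass) = Quot.mk _ x) =
      {x, G.arc x} := by
    ext y
    rw [Finset.mem_filter, eq_comm, arcClass_mk_eq_iff]
    simp
  rw [this, Finset.sum_pair (G.arc_ne x).symm]

theorem card_arcClass (G : ArrowPresentation E) :
    Nat.card G.ArcClass = 2 * Fintype.card E := by
  classical
  have := Fintype.ofFinite G.ArcClass
  have h := Finset.card_eq_sum_card_fiberwise (s := Finset.univ) (t := Finset.univ)
    (f := fun x : EdgeCorner E => (Quot.mk _ x : G.ArcClass)) (by simp)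
  have h2 : ∀ a : G.ArcClass,
      (Finset.univ.filter fun y : EdgeCorner E => (Quot.mk _ y : G.ArcClass) = a).card = 2 := by
    intro a
    induction a using Quot.ind with | _ x
    rw [Finset.card_eq_sum_ones]
    convert G.sum_arcClass_fiber (fun _ => 1) x
  rw [Finset.sum_congr rfl fun a _ => h2 a] at h
  simp at h
  rw [Nat.card_eq_fintype_card]
  omega

/-- The incidence matrix of the medial graph, over the field with two elements. -/
noncomputable def medialIncidence [DecidableEq E] (G : ArrowPresentation E) :
    Matrix E G.ArcClass (ZMod 2) :=
  open Classical in
  Matrix.of fun e a => ∑ x : EdgeCorner E with (Quot.mk _ x : G.ArcClass) = a,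
    if x.1 = e then 1 else 0

theorem vecMul_medialIncidence [DecidableEq E] (G : ArrowPresentation E) (ψ : E → ZMod 2)
    (x : EdgeCorner E) :
    Matrix.vecMul ψ G.medialIncidence (Quot.mk _ x) = ψ x.1 + ψ (G.arc x).1 := by
  classical
  simp only [Matrix.vecMul, dotProduct, medialIncidence, Matrix.of_apply, Finset.mul_sum]
  rw [Finset.sum_comm]
  simp only [mul_ite, mul_one, mul_zero, Finset.sum_ite_eq, Finset.mem_univ, if_true]
  convert G.sum_arcClass_fiber (fun x => ψ x.1) x

theorem mulVec_medialIncidence [DecidableEq E] (G : ArrowPresentation E) [Fintype G.ArcClass]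
    (φ : G.ArcClass → ZMod 2) (e : E) :
    Matrix.mulVec G.medialIncidence φ e = ∑ p : Bool × Bool, φ (Quot.mk _ (e, p)) := by
  classical
  simp only [Matrix.mulVec, dotProduct, medialIncidence, Matrix.of_apply, Finset.sum_mul,
    Finset.sum_filter]
  rw [Finset.sum_comm]
  have h : ∀ x : EdgeCorner E, (∑ a : G.ArcClass,
      if (Quot.mk _ x : G.ArcClass) = a then (if x.1 = e then (1 : ZMod 2) else 0) * φ a else 0) =
      if x.1 = e then φ (Quot.mk _ x) else 0 := by
    intro x
    simp
  simp only [ite_mul, zero_mul] at h ⊢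
  rw [Finset.sum_congr rfl fun x _ => h x, Fintype.sum_prod_type]
  rw [Finset.sum_eq_single e]
  · simp
  · intro b _ hb
    simp [hb]
  · simp

/-- Functions on the edges that vanish under the transposed incidence matrix are those that are
constant on components. -/
theorem finrank_ker_vecMul_medialIncidence [DecidableEq E] (G : ArrowPresentation E) :
    Module.finrank (ZMod 2) (LinearMap.ker G.medialIncidence.vecMulLinear) =
      Nat.card G.MarkedComponent := by
  classical
  have := Fintype.ofFinite G.MarkedComponent
  have hz : ∀ a b : ZMod 2, a + b = 0 ↔ b = a := by decide
  let L : (G.MarkedComponent → ZMod 2) →ₗ[ZMod 2] (E → ZMod 2) :=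
    LinearMap.funLeft _ _ fun e => Quot.mk _ (e, false, false)
  have hq : ∀ x : EdgeCorner E, (Quot.mk _ x : G.MarkedComponent) =
      Quot.mk _ (x.1, false, false) := by
    have s1 : ∀ x : EdgeCorner E, (Quot.mk _ x : G.MarkedComponent) = Quot.mk _ x.acrossArrow :=
      fun x => Quot.sound (.inr (.inl rfl))
    have s2 : ∀ x : EdgeCorner E, (Quot.mk _ x : G.MarkedComponent) = Quot.mk _ x.alongSide :=
      fun x => Quot.sound (.inr (.inr rfl))
    rintro ⟨e, _ | _, _ | _⟩
    · rfl
    · exact s1 _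
    · exact (s1 _).trans (s2 _)
    · exact s2 _
  have hinj : Function.Injective L := LinearMap.funLeft_injective_of_surjective _ _ _ (by
    intro q
    induction q using Quot.ind with | _ x
    exact ⟨x.1, (hq x).symm⟩)
  have hrange : LinearMap.range L = LinearMap.ker G.medialIncidence.vecMulLinear := by
    ext ψ
    rw [LinearMap.mem_range, LinearMap.mem_ker, Matrix.vecMulLinear_apply]
    constructor
    · rintro ⟨c, rfl⟩
      funext a
      induction a using Quot.ind with | _ x
      rw [vecMul_medialIncidence, Pi.zero_apply, hz]
      simp only [L, LinearMap.funLeft_apply]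
      rw [← hq, ← hq]
      exact congrArg c (Quot.sound (.inl rfl)).symm
    · intro h
      refine ⟨Quot.lift (fun x => ψ x.1) ?_, rfl⟩
      rintro x y (rfl | rfl | rfl)
      · have := congrFun h (Quot.mk _ x)
        rw [vecMul_medialIncidence, Pi.zero_apply, hz] at this
        exact this.symm
      · rfl
      · rfl
  rw [← hrange, LinearMap.finrank_range_of_inj hinj, Module.finrank_fintype_fun_eq_card,
    Nat.card_eq_fintype_card]

/-- The matrix and its transpose have equal rank, which is `|E|` minus the number of marked
components, and there are `2|E|` columns. -/
theorem finrank_ker_medialIncidence [DecidableEq E] (G : ArrowPresentation E)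
    [Fintype G.ArcClass] :
    Module.finrank (ZMod 2) (LinearMap.ker G.medialIncidence.mulVecLin) =
      Fintype.card E + Nat.card G.MarkedComponent := by
  classical
  have h1 := LinearMap.finrank_range_add_finrank_ker G.medialIncidence.mulVecLin
  have h2 := LinearMap.finrank_range_add_finrank_ker G.medialIncidence.vecMulLinear
  have h3 := G.finrank_ker_vecMul_medialIncidence
  have h4 := Matrix.rank_transpose G.medialIncidence
  have h5 := G.card_arcClass
  rw [Nat.card_eq_fintype_card] at h5
  rw [Matrix.rank, Matrix.rank, Matrix.mulVecLin_transpose] at h4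
  rw [Module.finrank_fintype_fun_eq_card] at h1 h2
  omega

/-- In characteristic 2, `h + g = 0` says that `h` and `g` agree at every corner. Their common value
is preserved by arcs, arrows and free sides, so it is a function on components. -/
theorem finrank_ker_sideSum (G : ArrowPresentation E) :
    Module.finrank (ZMod 2) (LinearMap.ker G.sideSum) = Nat.card G.MarkedComponent := by
  classical
  have := Fintype.ofFinite G.MarkedComponent
  have hz : ∀ a b : ZMod 2, a + b = 0 ↔ b = a := by decide
  let L : (G.MarkedComponent → ZMod 2) →ₗ[ZMod 2]
      ((G.MarkedCircle → ZMod 2) × (G.MarkedFace → ZMod 2)) :=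
    (LinearMap.funLeft _ _ (Quot.map id fun _ _ h => h.elim .inl fun h => .inr (.inl h))).prod
      (LinearMap.funLeft _ _ (Quot.map id fun _ _ h => h.elim .inl fun h => .inr (.inr h)))
  have hinj : Function.Injective L := by
    intro c d h
    funext q
    induction q using Quot.ind with | _ x
    exact congrFun (congrArg Prod.fst h) (Quot.mk _ x)
  have hrange : LinearMap.range L = LinearMap.ker G.sideSum := by
    ext ⟨h, g⟩
    rw [LinearMap.mem_range, LinearMap.mem_ker]
    constructor
    · rintro ⟨c, hc⟩
      rw [← hc]
      funext a
      induction a using Quot.ind with | _ x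
      exact (hz _ _).2 rfl
    · intro hs
      have hs' : ∀ x : EdgeCorner E, g (Quot.mk _ x) = h (Quot.mk _ x) := fun x =>
        (hz _ _).1 (congrFun hs (Quot.mk _ x))
      refine ⟨Quot.lift (fun x => h (Quot.mk _ x)) ?_, Prod.ext ?_ ?_⟩
      · rintro x y (hy | hy | hy)
        · exact congrArg h (Quot.sound (.inl hy))
        · exact congrArg h (Quot.sound (.inr hy))
        · rw [← hs', ← hs']
          exact congrArg g (Quot.sound (.inr hy))
      · funext q
        induction q using Quot.ind with | _ x
        rfl
      · funext q
        induction q using Quot.ind with | _ x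
        exact (hs' x).symm
  rw [← hrange, LinearMap.finrank_range_of_inj hinj, Module.finrank_fintype_fun_eq_card,
    Nat.card_eq_fintype_card]

/-- The first homology of the sphere vanishes: in the plane, every cycle modulo 2 of the medial
graph is the boundary of a set of circles and faces. -/
theorem range_sideSum_eq_ker_medialIncidence [DecidableEq E] (G : ArrowPresentation E)
    [Fintype G.ArcClass] (hG : G.IsPlane) :
    LinearMap.range G.sideSum = LinearMap.ker G.medialIncidence.mulVecLin := by
  classical
  have := Fintype.ofFinite G.MarkedCircle
  have := Fintype.ofFinite G.MarkedFace
  apply Submodule.eq_of_le_of_finrank_eq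
  -- Among the four corners at `e`, `h` takes each of its values at both ends of an arrow and `g` at
  -- both ends of a free side, so everything cancels mod 2.
  · rintro _ ⟨⟨h, g⟩, rfl⟩
    rw [LinearMap.mem_ker, Matrix.mulVecLin_apply]
    funext e
    have c : ∀ x : EdgeCorner E, (Quot.mk _ x.acrossArrow : G.MarkedCircle) = Quot.mk _ x :=
      fun x => (Quot.sound (.inr rfl)).symm
    have f : ∀ x : EdgeCorner E, (Quot.mk _ x.alongSide : G.MarkedFace) = Quot.mk _ x :=
      fun x => (Quot.sound (.inr rfl)).symm
    have c1 : (Quot.mk _ (e, false, true) : G.MarkedCircle) = Quot.mk _ (e, false, false) :=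
      c (e, false, false)
    have c2 : (Quot.mk _ (e, true, true) : G.MarkedCircle) = Quot.mk _ (e, true, false) :=
      c (e, true, false)
    have f1 : (Quot.mk _ (e, true, true) : G.MarkedFace) = Quot.mk _ (e, false, false) :=
      f (e, false, false)
    have f2 : (Quot.mk _ (e, true, false) : G.MarkedFace) = Quot.mk _ (e, false, true) :=
      f (e, false, true)
    rw [mulVec_medialIncidence, Pi.zero_apply, Fintype.sum_prod_type]
    simp only [Fintype.sum_bool, sideSum_apply, c1, c2, f1, f2]
    have hz : ∀ a b c d : ZMod 2, b + d + (b + c) + (a + c + (a + d)) = 0 := by decide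
    exact hz _ _ _ _
  · have h1 := LinearMap.finrank_range_add_finrank_ker G.sideSum
    rw [finrank_ker_sideSum, Module.finrank_prod, Module.finrank_fintype_fun_eq_card,
      Module.finrank_fintype_fun_eq_card] at h1
    rw [finrank_ker_medialIncidence]
    -- An isolated vertex adds one vertex, one face and one component, so `bare` cancels and Euler's
    -- formula concerns the marked part only.
    have hG : 2 * ((Nat.card G.MarkedComponent + G.bare : ℕ) : ℤ) -
        ((Nat.card (G.MarkedCircle ⊕ Fin G.bare) : ℤ) - Nat.card E +
          (Nat.card G.MarkedFace + G.bare : ℕ)) = 0 := hG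
    simp only [Nat.card_sum,
      Nat.card_eq_fintype_card (α := Fin _), Fintype.card_fin] at hG
    simp only [← Nat.card_eq_fintype_card] at h1 ⊢
    push_cast at hG
    omega

/-- A mod 2 cycle of the medial graph of a plane graph is the coboundary of a potential. -/
theorem IsPlane.exists_potential {G : ArrowPresentation E} (hG : G.IsPlane)
    (φ : EdgeCorner E → ZMod 2) (harc : ∀ x, φ (G.arc x) = φ x)
    (hsum : ∀ e, ∑ p : Bool × Bool, φ (e, p) = 0) :
    ∃ h g : EdgeCorner E → ZMod 2, (∀ x, h (G.arc x) = h x) ∧ (∀ x, h x.acrossArrow = h x) ∧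
      (∀ x, g x.alongSide = g x) ∧ ∀ x, φ x = h x + g x := by
  classical
  have := Fintype.ofFinite G.ArcClass
  let φ' : G.ArcClass → ZMod 2 := Quot.lift φ fun x y hy => by rw [hy, harc]
  have hmem : φ' ∈ LinearMap.range G.sideSum := by
    rw [G.range_sideSum_eq_ker_medialIncidence hG, LinearMap.mem_ker, Matrix.mulVecLin_apply]
    funext e
    rw [mulVec_medialIncidence]
    exact hsum e
  obtain ⟨⟨h, g⟩, hhg⟩ := hmem
  exact ⟨fun x => h (Quot.mk _ x), fun x => g (Quot.mk _ x),
    fun x => congrArg h (Quot.sound (.inl rfl)).symm,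
    fun x => congrArg h (Quot.sound (.inr rfl)).symm,
    fun x => congrArg g (Quot.sound (.inr rfl)).symm,
    fun x => (congrFun hhg (Quot.mk _ x)).symm⟩

end Finite

end ArrowPresentation

/-! ### Local colour patterns at an edge disc -/

namespace EdgeCorner

variable {E κ : Type*}

/-- At the edge disc `e`, the colouring `f` is constant along the two free sides, with two
different colours. -/
def IsSplitAt (f : EdgeCorner E → κ) (e : E) : Prop :=
  f (e, false, false) = f (e, true, true) ∧ f (e, false, true) = f (e, true, false) ∧
    f (e, false, false) ≠ f (e, false, true)

/-- At the edge disc `e`, the colouring `f` is constant on the two pairs of opposite corners, with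
two different colours. -/
def IsCrossedAt (f : EdgeCorner E → κ) (e : E) : Prop :=
  f (e, false, false) = f (e, true, false) ∧ f (e, false, true) = f (e, true, true) ∧
    f (e, false, false) ≠ f (e, false, true)

/-- At the vertex `e`, the colouring `f` of half-edges is constant on the pairs of the vertex state
`σ`. -/
def IsPairedAt (f : EdgeCorner E → κ) (e : E) (σ : VertexState) : Prop :=
  ∀ p : Bool × Bool, f (σ.pairing (e, p)) = f (e, p)

theorem IsSplitAt.not_isCrossedAt {f : EdgeCorner E → κ} {e : E} (h : IsSplitAt f e) :
    ¬ IsCrossedAt f e :=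
  fun h' => h.2.2 (h'.1.trans h.2.1.symm)

theorem IsCrossedAt.not_isSplitAt {f : EdgeCorner E → κ} {e : E} (h : IsCrossedAt f e) :
    ¬ IsSplitAt f e :=
  fun h' => h'.not_isCrossedAt h

theorem forall_iff {p : EdgeCorner E → Prop} :
    (∀ x, p x) ↔ ∀ e, p (e, false, false) ∧ p (e, false, true) ∧ p (e, true, false) ∧
      p (e, true, true) := by
  simp only [Prod.forall, Bool.forall_bool, and_assoc]

end EdgeCorner

/-! ### Parity of the number of crossings -/

namespace ArrowPresentation

open EdgeCorner

variable {E : Type*} [Fintype E]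

/-- In the plane, two curves of different colours cross an even number of times. -/
theorem IsPlane.even_card_crossings {G : ArrowPresentation E} (hG : G.IsPlane) {k : ℕ}
    (f : EdgeCorner E → Fin k) (harc : ∀ x, f (G.arc x) = f x)
    (hf : ∀ e, IsSplitAt f e ∨ IsCrossedAt f e) [DecidablePred (IsCrossedAt f)] :
    Even (Finset.univ.filter (IsCrossedAt f)).card := by
  classical
  -- Every colour occurs an even number of times at each `e`, so each colour class is a mod 2 cycle.
  have hpot : ∀ i : Fin k, ∃ h g : EdgeCorner E → ZMod 2, (∀ x, h (G.arc x) = h x) ∧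
      (∀ x, h x.acrossArrow = h x) ∧ (∀ x, g x.alongSide = g x) ∧
      ∀ x, (if f x = i then 1 else 0) = h x + g x := by
    intro i
    refine hG.exists_potential _ (fun x => by rw [harc]) fun e => ?_
    have hz : ∀ a b : ZMod 2, b + a + (b + a) = 0 ∧ a + b + (b + a) = 0 := by decide
    rw [Fintype.sum_prod_type]
    simp only [Fintype.sum_bool]
    rcases hf e with ⟨h1, h2, -⟩ | ⟨h1, h2, -⟩
    · rw [h1, h2]
      exact (hz _ _).2
    · rw [h1, h2]
      exact (hz _ _).1
  choose h g hharc hacross halong hfi using hpot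
  -- The two ends of an arc have the same colour and the same `h i`, so they cancel.
  have hzero : ∀ i, ∑ x : EdgeCorner E, (if i < f x then h i x else 0) = 0 := by
    intro i
    refine Finset.sum_involution (fun x _ => G.arc x) ?_ (fun x _ _ => G.arc_ne x)
      (fun _ _ => Finset.mem_univ _) (fun x _ => G.arc_arc x)
    intro x _
    rw [harc, hharc]
    exact CharTwo.add_self_eq_zero _
  -- The curves of colour `i` separate the two black sectors at `e` exactly when `e` is a crossing
  -- involving `i`. Restricting to colours above `i` makes each crossing count once, for the smaller
  -- of its two colours.
  have hlocal : ∀ i e, ∑ p : Bool × Bool, (if i < f (e, p) then h i (e, p) else 0) =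
      if i = min (f (e, false, false)) (f (e, false, true)) then
        (if IsCrossedAt f e then 1 else 0) else 0 := by
    intro i e
    have a1 : h i (e, false, true) = h i (e, false, false) := hacross i (e, false, false)
    have a2 : h i (e, true, true) = h i (e, true, false) := hacross i (e, true, false)
    have s1 : g i (e, true, true) = g i (e, false, false) := halong i (e, false, false)
    have s2 : g i (e, true, false) = g i (e, false, true) := halong i (e, false, true)
    have f1 := hfi i (e, false, false)
    have f2 := hfi i (e, false, true)
    have f3 := hfi i (e, true, false)
    have f4 := hfi i (e, true, true)
    rw [Fintype.sum_prod_type]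
    simp only [Fintype.sum_bool]
    rw [a1, a2]
    rw [a1] at f2
    rw [s2] at f3
    rw [a2, s1] at f4
    rcases hf e with hs | hx
    · have hw : h i (e, true, false) = h i (e, false, false) := by
        rw [← hs.1] at f4
        exact add_right_cancel (f4.symm.trans f1)
      rw [if_neg hs.not_isCrossedAt, ite_self, hw, hs.1, hs.2.1]
      generalize (if i < f (e, true, true) then h i (e, false, false) else 0) = a
      generalize (if i < f (e, true, false) then h i (e, false, false) else 0) = b
      revert a b
      decide
    · rw [if_pos hx]
      obtain ⟨h1, h2, h3⟩ := hx
      rw [← h1] at f3 ⊢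
      rw [← h2] at f4 ⊢
      generalize f (e, false, false) = A at *
      generalize f (e, false, true) = B at *
      generalize h i (e, true, false) = p at *
      generalize h i (e, false, false) = q at *
      generalize g i (e, false, true) = r at *
      generalize g i (e, false, false) = s at *
      clear a1 a2 s1 s2 h1 h2
      have hW : i = min A B ↔ (A = i ∧ i < B) ∨ (B = i ∧ i < A) := by grind
      have hU : A = i → ¬ i < A := by grind
      have hV : B = i → ¬ i < B := by grind
      have hPQ : ¬ (A = i ∧ B = i) := fun h => h3 (h.1.trans h.2.symm)
      rw [if_congr hW rfl rfl]
      -- The order relations between `i`, `A` and `B` enter only through four truth values, which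
      -- leaves a finite check.
      have key : ∀ P Q U V : Bool, ¬(P ∧ Q) → (P → ¬U) → (Q → ¬V) → ∀ p q r s : ZMod 2,
          (if P then 1 else 0) = q + s → (if Q then 1 else 0) = q + r →
          (if P then 1 else 0) = p + r → (if Q then 1 else 0) = p + s →
          (if V then p else 0) + (if U then p else 0) +
            ((if V then q else 0) + (if U then q else 0)) =
              if (P ∧ V) ∨ (Q ∧ U) then 1 else 0 := by decide
      have := key (decide (A = i)) (decide (B = i)) (decide (i < A)) (decide (i < B))
      simp only [decide_eq_true_eq] at this
      exact this hPQ hU hV p q r s f1 f2 f3 f4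
  have hcount : ((Finset.univ.filter (IsCrossedAt f)).card : ZMod 2) = 0 := by
    rw [← Finset.sum_boole]
    calc ∑ e, (if IsCrossedAt f e then (1 : ZMod 2) else 0)
        = ∑ e, ∑ i, ∑ p : Bool × Bool, (if i < f (e, p) then h i (e, p) else 0) := by
          simp [hlocal]
      _ = ∑ i, ∑ x : EdgeCorner E, (if i < f x then h i x else 0) := by
          rw [Finset.sum_comm]
          simp only [Fintype.sum_prod_type]
      _ = 0 := Finset.sum_eq_zero fun i _ => hzero i
  exact (ZMod.natCast_eq_zero_iff_even).1 hcount

end ArrowPresentation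

/-! ### Both sides as counts of medial colourings -/

namespace ArrowPresentation

open EdgeCorner

variable {E : Type*}

theorem partialPetrial_empty [DecidableEq E] (G : ArrowPresentation E) :
    G.partialPetrial ∅ = G := by
  have h : twist (∅ : Finset E) = Equiv.refl _ := by
    ext x : 1
    simp [twist]
  rw [partialPetrial, h]
  rfl

/-- Proper colourings of the vertices in terms of the ends of the arrows. -/
theorem numProperColorings_toGraph (H : ArrowPresentation E) (k : ℕ) :
    H.toGraph.numProperColorings k = Nat.card {f : EdgeCorner E → Fin k //
      (∀ x, f (H.arc x) = f x) ∧ (∀ x, f x.acrossArrow = f x) ∧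
        ∀ e, f (e, false, false) ≠ f (e, true, false)} * k ^ H.bare := by
  have hpow : k ^ H.bare = Nat.card (Fin H.bare → Fin k) := by simp
  rw [hpow, ← Nat.card_prod, Graph.numProperColorings]
  refine Nat.card_congr
    { toFun := fun c => (⟨fun x => c.1 ⟨H.circleOf x, trivial⟩, ?_, ?_, ?_⟩,
        fun i => c.1 ⟨.inr i, trivial⟩)
      invFun := fun p => ⟨fun v => Sum.elim
        (Quot.lift p.1.1 (by
          rintro x y (rfl | rfl)
          · exact (p.1.2.1 x).symm
          · exact (p.1.2.2.1 x).symm)) p.2 v.1, ?_⟩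
      left_inv := ?_
      right_inv := ?_ }
  · intro x
    have : H.circleOf (H.arc x) = H.circleOf x := congrArg Sum.inl (Quot.sound (.inl rfl)).symm
    simp only [this]
  · intro x
    have : H.circleOf x.acrossArrow = H.circleOf x :=
      congrArg Sum.inl (Quot.sound (.inr rfl)).symm
    simp only [this]
  · exact fun e => c.2 e _ _ (.inl ⟨rfl, rfl⟩)
  · rintro e ⟨x, _⟩ ⟨y, _⟩ (⟨hx, hy⟩ | ⟨hx, hy⟩)
    · change x = H.circleOf _ at hx
      change y = H.circleOf _ at hy
      subst hx hy
      exact p.1.2.2.2 e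
    · change x = H.circleOf _ at hx
      change y = H.circleOf _ at hy
      subst hx hy
      exact (p.1.2.2.2 e).symm
  · rintro ⟨c, hc⟩
    apply Subtype.ext
    funext ⟨v, hv⟩
    rcases v with q | i
    · induction q using Quot.ind
      rfl
    · rfl
  · rintro ⟨⟨f, hf⟩, g⟩
    rfl

variable [Fintype E]

open Classical in
/-- The value of the Penrose polynomial at `k` as a signed count of colourings of the edges of the
medial graph. -/
theorem penrosePolynomial_eval [DecidableEq E] (G : ArrowPresentation E) (k : ℕ) :
    G.penrosePolynomial.eval (k : ℤ) = (k : ℤ) ^ G.bare *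
      ∑ f : EdgeCorner E → Fin k with ∀ x, f (G.arc x) = f x,
        ∏ e, ((if IsSplitAt f e then 1 else 0) - if IsCrossedAt f e then 1 else 0) := by
  have hstate : ∀ s : E → VertexState, (k : ℤ) ^ G.medialGraph.stateComponents s =
      (k : ℤ) ^ G.bare * ∑ f : EdgeCorner E → Fin k with ∀ x, f (G.arc x) = f x,
        ∏ e, if IsPairedAt f e (s e) then 1 else 0 := by
    intro s
    have h := Graph.card_colorings_constant
      (fun x y : EdgeCorner E => y = G.arc x ∨ y = (s x.1).pairing x) k
    simp only [Fintype.prod_boole, Finset.sum_boole, Finset.filter_filter]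
    rw [CheckerboardGraph.stateComponents, pow_add, mul_comm]
    congr 1
    rw [← Nat.cast_pow]
    congr 1
    refine h.symm.trans ?_
    rw [Nat.card_eq_fintype_card, Fintype.card_subtype]
    congr 1
    ext f
    simp only [Finset.mem_filter, Finset.mem_univ, true_and]
    constructor
    · exact fun hf => ⟨fun x => (hf _ _ (.inl rfl)).symm, fun e p => (hf (e, p) _ (.inr rfl)).symm⟩
    · rintro ⟨h1, h2⟩ x y (rfl | rfl)
      · exact (h1 x).symm
      · exact (h2 x.1 x.2).symm
  -- If all four colours agree, the white split and the crossing both apply and their weights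
  -- cancel; this is where the two colours become distinct.
  have hlocal : ∀ (f : EdgeCorner E → Fin k) (e : E),
      ∑ σ : VertexState, penroseWeight σ * (if IsPairedAt f e σ then (1 : ℤ) else 0) =
        (if IsSplitAt f e then 1 else 0) - if IsCrossedAt f e then 1 else 0 := by
    intro f e
    have hu : (Finset.univ : Finset VertexState) = {.whiteSplit, .blackSplit, .crossing} := rfl
    have hw : IsPairedAt f e .whiteSplit ↔
        f (e, false, false) = f (e, true, true) ∧ f (e, false, true) = f (e, true, false) := by
      simp only [IsPairedAt, VertexState.pairing, alongSide, Prod.forall, Bool.forall_bool,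
        Bool.not_false, Bool.not_true]
      grind
    have hc : IsPairedAt f e .crossing ↔
        f (e, false, false) = f (e, true, false) ∧ f (e, false, true) = f (e, true, true) := by
      simp only [IsPairedAt, VertexState.pairing, opposite, Prod.forall, Bool.forall_bool,
        Bool.not_false, Bool.not_true]
      grind
    rw [hu, Finset.sum_insert (by decide), Finset.sum_insert (by decide), Finset.sum_singleton]
    simp only [penroseWeight, hw, hc, IsSplitAt, IsCrossedAt]
    grind
  rw [penrosePolynomial, CheckerboardGraph.transitionPolynomial, Polynomial.eval_finsetSum]
  simp only [Polynomial.eval_mul, Polynomial.eval_C, Polynomial.eval_pow, Polynomial.eval_X,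
    hstate]
  simp only [← hlocal, Finset.prod_univ_sum, Fintype.piFinset_univ, Finset.prod_mul_distrib]
  rw [Finset.sum_comm, Finset.mul_sum]
  refine Finset.sum_congr rfl fun s _ => ?_
  rw [← Finset.mul_sum]
  ring

open Classical in
/-- The proper colourings of the dual of a partial Petrial are the colourings of the edges of the
medial graph that are crossed exactly at the twisted edges. -/
theorem numProperColorings_geometricDual_partialPetrial [DecidableEq E] (G : ArrowPresentation E)
    (A : Finset E) (k : ℕ) :
    ((G.partialPetrial A).geometricDual.toGraph.numProperColorings k : ℤ) = (k : ℤ) ^ G.bare *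
      ∑ f : EdgeCorner E → Fin k with ∀ x, f (G.arc x) = f x,
        ∏ e, if e ∈ A then (if IsCrossedAt f e then 1 else 0) else
          if IsSplitAt f e then 1 else 0 := by
  have hprod : ∀ f : EdgeCorner E → Fin k,
      (∏ e, if e ∈ A then (if IsCrossedAt f e then (1 : ℤ) else 0) else
        if IsSplitAt f e then 1 else 0) =
      if ∀ e, if e ∈ A then IsCrossedAt f e else IsSplitAt f e then 1 else 0 := by
    intro f
    rw [← Fintype.prod_boole]
    refine Finset.prod_congr rfl fun e _ => ?_
    split_ifs <;> rfl
  simp only [hprod, Finset.sum_boole, Finset.filter_filter]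
  rw [numProperColorings_toGraph, mul_comm]
  push_cast
  refine congrArg₂ _ rfl (congrArg _ ?_)
  -- `ρ` carries the ends of the dual's arrows back to corners of `G`. The dual's arrows run along
  -- the free sides, and a half-twist turns these into the diagonals.
  let ρ : Equiv.Perm (EdgeCorner E) := (dualize Finset.univ).trans (twist A)
  have harc : ∀ x, (G.partialPetrial A).geometricDual.arc x = ρ.symm (G.arc (ρ x)) :=
    fun x => rfl
  rw [← Fintype.card_subtype, ← Nat.card_eq_fintype_card]
  refine Nat.card_congr (Equiv.subtypeEquiv (ρ.arrowCongr (Equiv.refl _)) fun f => ?_)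
  obtain ⟨f, rfl⟩ := (ρ.symm.arrowCongr (Equiv.refl (Fin k))).surjective f
  have hf : (ρ.arrowCongr (Equiv.refl (Fin k))) (ρ.symm.arrowCongr (Equiv.refl (Fin k)) f) = f :=
    (ρ.arrowCongr (Equiv.refl (Fin k))).apply_symm_apply f
  have hf' : ∀ x, ρ.symm.arrowCongr (Equiv.refl (Fin k)) f x = f (ρ x) := fun x => rfl
  rw [hf]
  simp only [hf', harc, Equiv.apply_symm_apply]
  refine and_congr ?_ ?_
  · exact ρ.forall_congr_left.trans (by simp)
  · rw [forall_iff, ← forall_and]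
    refine forall_congr' fun e => ?_
    by_cases hA : e ∈ A
    · simp [ρ, dualize, twist, acrossArrow, hA, IsCrossedAt]
      grind
    · simp [ρ, dualize, twist, acrossArrow, hA, IsSplitAt]
      grind

/-! ### Removing the signs -/

open Classical in
/-- In the plane the signs of the Penrose polynomial are all positive. -/
theorem IsPlane.prod_sub_eq_prod_add {G : ArrowPresentation E} (hG : G.IsPlane) {k : ℕ}
    (f : EdgeCorner E → Fin k) (harc : ∀ x, f (G.arc x) = f x) :
    ∏ e, ((if IsSplitAt f e then (1 : ℤ) else 0) - if IsCrossedAt f e then 1 else 0) =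
      ∏ e, ((if IsCrossedAt f e then (1 : ℤ) else 0) + if IsSplitAt f e then 1 else 0) := by
  by_cases hf : ∀ e, IsSplitAt f e ∨ IsCrossedAt f e
  · have h1 : ∀ e, ((if IsSplitAt f e then (1 : ℤ) else 0) - if IsCrossedAt f e then 1 else 0) =
        if IsCrossedAt f e then -1 else 1 := by
      intro e
      rcases hf e with h | h
      · simp [h, h.not_isCrossedAt]
      · simp [h, h.not_isSplitAt]
    have h2 : ∀ e, ((if IsCrossedAt f e then (1 : ℤ) else 0) + if IsSplitAt f e then 1 else 0) =
        1 := by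
      intro e
      rcases hf e with h | h
      · simp [h, h.not_isCrossedAt]
      · simp [h, h.not_isSplitAt]
    simp only [h1, h2, Finset.prod_const_one]
    rw [← Finset.prod_filter, Finset.prod_const]
    exact (hG.even_card_crossings f harc hf).neg_one_pow
  -- An edge that is neither split nor crossed makes both products vanish.
  · push Not at hf
    obtain ⟨e, h1, h2⟩ := hf
    rw [Finset.prod_eq_zero (Finset.mem_univ e), Finset.prod_eq_zero (Finset.mem_univ e)]
    · simp [h1, h2]
    · simp [h1, h2]

theorem IsPlane.penrosePolynomial_eval_eq_sum [DecidableEq E] {G : ArrowPresentation E}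
    (hG : G.IsPlane) (k : ℕ) :
    G.penrosePolynomial.eval (k : ℤ) = ∑ A : Finset E,
      ((G.partialPetrial A).geometricDual.toGraph.numProperColorings k : ℤ) := by
  classical
  simp only [penrosePolynomial_eval, numProperColorings_geometricDual_partialPetrial]
  rw [← Finset.mul_sum, Finset.sum_comm]
  congr 1
  refine Finset.sum_congr rfl fun f hf => ?_
  -- Expanding the product, `A` is the set of edges where the crossed summand is chosen.
  rw [hG.prod_sub_eq_prod_add f (Finset.mem_filter.1 hf).2, Finset.prod_add, Finset.powerset_univ]
  refine Finset.sum_congr rfl fun A _ => ?_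
  symm
  rw [Finset.prod_ite]
  refine congrArg₂ _ (Finset.prod_congr ?_ fun _ _ => rfl) (Finset.prod_congr ?_ fun _ _ => rfl)
  · simp
  · ext e
    simp

end ArrowPresentation

theorem theoremt {E : Type*} [Fintype E] [DecidableEq E] (G : ArrowPresentation E)
    (hG : G.IsPlane) :
    G.penrosePolynomial =
        ∑ A : Finset E, (G.partialPetrial A).geometricDual.toGraph.chromaticPolynomial ∧
      ∀ k : ℕ, G.geometricDual.toGraph.chromaticPolynomial.eval (k : ℤ) ≤
        G.penrosePolynomial.eval (k : ℤ) := by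
  constructor
  · refine Polynomial.eq_of_infinite_eval_eq _ _
      ((Set.infinite_range_of_injective (Nat.cast_injective (R := ℤ))).mono ?_)
    rintro _ ⟨k, rfl⟩
    rw [Set.mem_ofPred_eq, hG.penrosePolynomial_eval_eq_sum, Polynomial.eval_finsetSum]
    simp only [Graph.chromaticPolynomial_eval]
  · intro k
    rw [hG.penrosePolynomial_eval_eq_sum, Graph.chromaticPolynomial_eval]
    calc (G.geometricDual.toGraph.numProperColorings k : ℤ)
        = ((G.partialPetrial ∅).geometricDual.toGraph.numProperColorings k : ℤ) := by
          rw [G.partialPetrial_empty]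
      -- The dual of `G` is the term `A = ∅`, and all other terms are nonnegative counts.
      _ ≤ _ := Finset.single_le_sum (f := fun A : Finset E =>
          ((G.partialPetrial A).geometricDual.toGraph.numProperColorings k : ℤ))
          (fun _ _ => Nat.cast_nonneg _) (Finset.mem_univ _)
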